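/- **Model.** Consider a synchronous network on $n$ nodes with identifiers $0,\dots,n-1$. It starts as the empty graph $G_0$ and is the graph $G_i=(V,E_i)$ in round $i\ge 1$, where $G_1,G_2,\dots$ are arbitrary graphs on the same node set $V$ (any number of edges may be inserted and deleted in each round). A deterministic distributed dynamic data structure with $b$-bit messages consists of a local part $DS_v$ at each node $v$. In round $i$, every node $v$ first learns which edges at $v$ were inserted and which were deleted between $G_{i-1}$ and $G_i$, and updates $DS_v$. It then sends a message of at most $b$ bits to each of its neighbors in $G_i$ (possibly different messages to different neighbors), reads the messages of its neighbors, and updates $DS_v$ again. At the end of the round $DS_v$ can be queried. It answers without communication: either it is in an inconsistent state and answers *inconsistent*, or it answers *true* or *false*. Local states and local computation are deterministic and otherwise unrestricted. The data structure solves **$k$-clique membership listing** if, for every sequence $(G_i)$ as above, at the end of every round $i$, every node $v$ responds to every query $H\subseteq V$ with $|H|=k$ and $v\in H$ either *inconsistent*, or *true* if $H$ is a clique in $G_i$ and *false* if it is not. It **handles edge insertions and deletions in at most $C$ amortized rounds** if, for every such sequence and every $i$, the number of rounds $j\in\{1,\dots,i\}$ at the end of which some $DS_v$ is in an inconsistent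 state is at most $C\sum_{j=1}^{i}|E_{j-1}\,\triangle\,E_j|$. **Corollary.** There are absolute constants $c,C\in\mathbb{N}$ such that for every integer $k\ge 3$ and every $n$ there is a deterministic distributed dynamic data structure on $n$ nodes, with messages of at most $c\lceil\log_2 n\rceil$ bits, that solves $k$-clique membership listing and handles edge insertions and deletions in at most $C$ amortized rounds. -/

import Mathlib

/-- Messages of at most `b` bits. -/
abbrev Message (b : ℕ) : Type := {m : List Bool // m.length ≤ b}

/-- What a node can say when it is queried. -/
inductive Response : Type
  | yes
  | no
  | inconsistent

/-- A deterministic distributed dynamic data structure for networks on the `n` nodes `Fin n`, in which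
every message has at most `b` bits. Each node `v` holds a local state, which plays the role of `DS_v`.
All components are functions of the node's identifier and of data local to that node. -/
structure DynamicDS (n b : ℕ) where
  /-- the local states of a node -/
  State : Type
  /-- the initial state of node `v` -/
  init : Fin n → State
  /-- `react v s ins del`: in state `s`, node `v` learns at the beginning of a round that exactly the
  edges from `v` to the nodes of `ins` were inserted and those to the nodes of `del` were deleted -/
  react : Fin n → State → Set (Fin n) → Set (Fin n) → State
  /-- `send v s u`: the message that `v`, in state `s` (after reacting to the topology changes),
  sends to its neighbour `u` -/
  send : Fin n → State → Fin n → Message b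
  /-- `receive v s inbox`: the state of `v` after reading the messages of this round; `inbox u` is
  the message from `u`, or `none` when `u` is not a neighbour of `v` in this round -/
  receive : Fin n → State → (Fin n → Option (Message b)) → State
  /-- whether the data structure at `v` declares itself consistent -/
  consistent : Fin n → State → Bool
  /-- `answer v s H`: the answer of a consistent node `v` to the query `H` -/
  answer : Fin n → State → Finset (Fin n) → Bool

namespace DynamicDS

variable {n b : ℕ}

/-- The response of node `v` in state `s` to the query `H`; it depends on the local state only. -/
def respond (D : DynamicDS n b) (v : Fin n) (s : D.State) (H : Finset (Fin n)) : Response :=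
  if D.consistent v s then (if D.answer v s H then Response.yes else Response.no)
  else Response.inconsistent

/-- The states of all nodes after they were notified of the topology changes that turn the graph
`G` into the graph `G'`, and before any communication. -/
def reacted (D : DynamicDS n b) (G G' : SimpleGraph (Fin n)) (s : Fin n → D.State) :
    Fin n → D.State :=
  fun v => D.react v (s v) (G'.neighborSet v \ G.neighborSet v)
    (G.neighborSet v \ G'.neighborSet v)

open Classical in
/-- The states of all nodes at the end of a communication round in the graph `G'`: every node `v`
receives, from each neighbour `u` in `G'`, the message that `u` addressed to `v`. -/
noncomputable def communicated (D : DynamicDS n b) (G' : SimpleGraph (Fin n))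
    (s : Fin n → D.State) : Fin n → D.State :=
  fun v => D.receive v (s v) fun u => if G'.Adj v u then some (D.send u (s u) v) else none

/-- `D.run G i v` is the state of node `v` at the end of round `i`, when `G i` is the graph in
round `i`. The network starts as `G 0`, and the rounds are numbered from `1`. -/
noncomputable def run (D : DynamicDS n b) (G : ℕ → SimpleGraph (Fin n)) : ℕ → Fin n → D.State
  | 0 => D.init
  | i + 1 => D.communicated (G (i + 1)) (D.reacted (G i) (G (i + 1)) (D.run G i))

/-- The data structure solves `k`-clique membership listing: on every evolution of the network from
the empty graph, at the end of every round `i`, every node `v` responds to every `k`-set `H` of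
nodes with `v ∈ H` by "inconsistent", or correctly by whether `H` is a `k`-clique in the current
graph `G i`. -/
def SolvesCliqueMembershipListing (D : DynamicDS n b) (k : ℕ) : Prop :=
  ∀ G : ℕ → SimpleGraph (Fin n), G 0 = ⊥ →
    ∀ (i : ℕ) (v : Fin n) (H : Finset (Fin n)), v ∈ H → H.card = k →
      (D.respond v (D.run G i v) H = Response.yes → (G i).IsNClique k H) ∧
      (D.respond v (D.run G i v) H = Response.no → ¬ (G i).IsNClique k H)

/-- The number of rounds among `1, …, i` at the end of which at least one node is inconsistent. -/
noncomputable def inconsistentRounds (D : DynamicDS n b) (G : ℕ → SimpleGraph (Fin n)) (i : ℕ) :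
    ℕ :=
  Set.ncard {j : ℕ | 1 ≤ j ∧ j ≤ i ∧ ∃ v, D.consistent v (D.run G j v) = false}

end DynamicDS

/-- The number of topology changes (edges inserted or deleted) in the rounds `1, …, i`. -/
noncomputable def topologyChanges {n : ℕ} (G : ℕ → SimpleGraph (Fin n)) (i : ℕ) : ℕ :=
  ∑ j ∈ Finset.range i, Set.ncard (symmDiff (G j).edgeSet (G (j + 1)).edgeSet)

/-- The amortized round complexity of the data structure is at most `C`: on every evolution of the
network from the empty graph, up to every round `i`, the number of rounds with an inconsistent node
is at most `C` times the number of topology changes. -/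
def DynamicDS.AmortizedRoundsAtMost {n b : ℕ} (D : DynamicDS n b) (C : ℕ) : Prop :=
  ∀ G : ℕ → SimpleGraph (Fin n), G 0 = ⊥ →
    ∀ i : ℕ, D.inconsistentRounds G i ≤ C * topologyChanges G i

/-! Each node queues the nodes to which its adjacency changed and announces one per round to all
neighbors, with the current truth value. An announcement is also a question: in the next round the
neighbors reply whether they are adjacent to the announced node. So a change of `uw` reaches common
neighbors through the queues of `u` and `w`, while a node `v` gaining a neighbor `u` asks its
neighbors about `u`. Hence beliefs about pairs of neighbors are correct except where a report is due
(`known_iff_or_unreported`), and none is due at a settled node. For the cost, the total queue length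
is a potential: a changed edge adds at most 2, and a round that ends with an unsettled node removes
at least 1 (`ncard_unsettled_add_backlog_le`). -/

/-- The content of a message: an announced node, whether the sender is adjacent to it, whether the
sender is adjacent to the node that the recipient announced in the previous round, and whether the
sender has further announcements to make. -/
abbrev Packet (n : ℕ) : Type := Option (Fin n) × Bool × Bool × Bool

/-- The local state of a node in the clique listing protocol. -/
structure ListingState (n : ℕ) : Type where
  /-- the current neighbours -/
  nbrs : Set (Fin n)
  /-- the nodes whose adjacency to this node changed and was not announced since -/
  pending : Set (Fin n)
  /-- the node announced in the last round -/
  asked : Option (Fin n)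
  /-- the node that a given neighbour announced in the last round -/
  heard : Fin n → Option (Fin n)
  /-- the pairs believed to be adjacent -/
  known : Fin n → Fin n → Prop
  /-- whether some neighbour has further announcements to make -/
  neighborBusy : Prop

namespace ListingState

variable {n : ℕ}

open Classical in
/-- The node to be announced next. -/
noncomputable def topic (s : ListingState n) : Option (Fin n) :=
  if h : s.pending.Nonempty then some h.choose else none

/-- The nodes still to be announced after the next announcement. -/
def remaining (s : ListingState n) : Set (Fin n) := {w ∈ s.pending | s.topic ≠ some w}

/-- The state after the notification of topology changes. -/
def react (s : ListingState n) (ins del : Set (Fin n)) : ListingState n :=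
  { s with nbrs := (s.nbrs ∪ ins) \ del, pending := s.pending ∪ (ins ∪ del) }

open Classical in
/-- The content of the message sent to the neighbour `u`. -/
noncomputable def packet (s : ListingState n) (u : Fin n) : Packet n :=
  (s.topic, decide (∃ w ∈ s.nbrs, s.topic = some w), decide (∃ w ∈ s.nbrs, s.heard u = some w),
    decide s.remaining.Nonempty)

/-- In the given inbox, `u` reports that its adjacency to `w` has truth value `a`. -/
def Told (s : ListingState n) (inbox : Fin n → Option (Packet n)) (u w : Fin n) (a : Bool) : Prop :=
  ∃ p, inbox u = some p ∧ ((p.1 = some w ∧ p.2.1 = a) ∨ (s.asked = some w ∧ p.2.2.1 = a))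

/-- The state after reading the inbox. -/
noncomputable def receive (s : ListingState n) (inbox : Fin n → Option (Packet n)) : ListingState n where
  nbrs := s.nbrs
  pending := s.remaining
  asked := s.topic
  heard u := (inbox u).bind Prod.fst
  known u w := (s.Told inbox u w true ∨ s.Told inbox w u true) ∨
    (s.known u w ∧ ¬ (s.Told inbox u w false ∨ s.Told inbox w u false))
  neighborBusy := ∃ u p, inbox u = some p ∧ p.2.2.2 = true

/-- The state allows queries to be answered. -/
def Settled (s : ListingState n) : Prop :=
  s.pending = ∅ ∧ s.asked = none ∧ ¬ s.neighborBusy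

/-- The beliefs of the node `v` imply that `H` is a clique. -/
def BelievesClique (s : ListingState n) (v : Fin n) (H : Finset (Fin n)) : Prop :=
  ∀ u ∈ H, u ≠ v → u ∈ s.nbrs ∧ ∀ w ∈ H, w ≠ v → u ≠ w → s.known u w

theorem topic_mem {s : ListingState n} {w : Fin n} (h : s.topic = some w) : w ∈ s.pending := by
  unfold topic at h
  split_ifs at h with hs
  rw [← Option.some.inj h]
  exact hs.choose_spec

theorem exists_topic {s : ListingState n} (h : s.pending.Nonempty) : ∃ w, s.topic = some w := by
  simp [topic, h]

theorem topic_or_remaining {s : ListingState n} {w : Fin n} (h : w ∈ s.pending) :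
    s.topic = some w ∨ w ∈ s.remaining := by
  by_cases hw : s.topic = some w
  · exact .inl hw
  · exact .inr ⟨h, hw⟩

theorem remaining_subset (s : ListingState n) : s.remaining ⊆ s.pending := fun _ h => h.1

theorem ncard_remaining_lt {s : ListingState n} (h : s.pending.Nonempty) :
    s.remaining.ncard < s.pending.ncard := by
  obtain ⟨w, hw⟩ := exists_topic h
  refine Set.ncard_lt_ncard ⟨s.remaining_subset, fun hs => (hs (topic_mem hw)).2 hw⟩
    (Set.toFinite _)

end ListingState

open Classical in
/-- The clique listing protocol, for a given encoding of packets as messages. -/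
noncomputable def listingDS {n b : ℕ} (enc : Packet n → Message b) (dec : Message b → Packet n) :
    DynamicDS n b where
  State := ListingState n
  init _ := ⟨∅, ∅, none, fun _ => none, fun _ _ => False, False⟩
  react _ s ins del := s.react ins del
  send _ s u := enc (s.packet u)
  receive _ s inbox := s.receive fun u => (inbox u).map dec
  consistent _ s := decide s.Settled
  answer v s H := decide (s.BelievesClique v H)

/-! ### Executions of the protocol and truth of the reports. -/

namespace Listing

variable {n : ℕ} (G : ℕ → SimpleGraph (Fin n))

/-- The states after the notification of topology changes, from the states `s` before it. -/
def reacted (A B : SimpleGraph (Fin n)) (s : Fin n → ListingState n) (v : Fin n) : ListingState n :=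
  (s v).react (B.neighborSet v \ A.neighborSet v) (A.neighborSet v \ B.neighborSet v)

open Classical in
/-- The packets that `v` receives in the graph `B`, from nodes in the states `s`. -/
noncomputable def inbox (B : SimpleGraph (Fin n)) (s : Fin n → ListingState n) (v u : Fin n) :
    Option (Packet n) :=
  if B.Adj v u then some ((s u).packet v) else none

/-- The states of the protocol at the end of each round. -/
noncomputable def run : ℕ → Fin n → ListingState n
  | 0, _ => ⟨∅, ∅, none, fun _ => none, fun _ _ => False, False⟩
  | i + 1, v => (reacted (G i) (G (i + 1)) (run i) v).receive
      (inbox (G (i + 1)) (reacted (G i) (G (i + 1)) (run i)) v)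

theorem listingDS_run {b : ℕ} {enc : Packet n → Message b} {dec : Message b → Packet n}
    (h : ∀ p, dec (enc p) = p) (i : ℕ) : (listingDS enc dec).run G i = run G i := by
  induction i with
  | zero => rfl
  | succ i ih =>
    funext v
    rw [DynamicDS.run, ih]
    refine congrArg (ListingState.receive (reacted (G i) (G (i + 1)) (run G i) v)) ?_
    funext u
    unfold inbox
    by_cases hu : (G (i + 1)).Adj v u
    · simp only [hu, if_true, Option.map_some]
      exact congrArg some (h _)
    · simp [hu]

variable {G}

theorem nbrs_run (h0 : G 0 = ⊥) (i : ℕ) (v : Fin n) : (run G i v).nbrs = (G i).neighborSet v := by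
  induction i with
  | zero => ext u; simp [run, h0]
  | succ i ih =>
    ext u
    simp only [run, ListingState.receive, reacted, ListingState.react, ih, Set.mem_sdiff,
      Set.mem_union]
    tauto

theorem nbrs_reacted (h0 : G 0 = ⊥) (i : ℕ) (v : Fin n) :
    (reacted (G i) (G (i + 1)) (run G i) v).nbrs = (G (i + 1)).neighborSet v :=
  nbrs_run h0 (i + 1) v

theorem heard_run (h0 : G 0 = ⊥) {i : ℕ} {v u : Fin n} (h : (G i).Adj v u) :
    (run G i v).heard u = (run G i u).asked := by
  cases i with
  | zero => simp [h0] at h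
  | succ i => simp [run, ListingState.receive, inbox, h, ListingState.packet]

/-- Both bits are computed from the updated neighborhood of the sender. Adjacency in round `i` is
needed for replies: otherwise `u` never heard the question of `v` and its default bit `false` may be
wrong. -/
theorem told_iff (h0 : G 0 = ⊥) {i : ℕ} {v u w : Fin n} {a : Bool} (h : (G i).Adj v u)
    (h' : (G (i + 1)).Adj v u)
    (ht : (reacted (G i) (G (i + 1)) (run G i) v).Told
      (inbox (G (i + 1)) (reacted (G i) (G (i + 1)) (run G i)) v) u w a) :
    a = true ↔ (G (i + 1)).Adj u w := by
  obtain ⟨p, hp, hpa⟩ := ht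
  rw [inbox, if_pos h'] at hp
  obtain rfl := Option.some.inj hp
  rcases hpa with ⟨h1, rfl⟩ | ⟨h1, rfl⟩
  · change (reacted (G i) (G (i + 1)) (run G i) u).topic = some w at h1
    simp [ListingState.packet, h1, nbrs_reacted h0]
  · have h2 : (reacted (G i) (G (i + 1)) (run G i) u).heard v = some w := by
      rw [← h1]
      exact heard_run h0 h.symm
    simp [ListingState.packet, h2, nbrs_reacted h0]

/-! ### Correctness of settled nodes. -/

/-- At the end of round `i`, the adjacency of `u` and `w` still has to be reported to `v`. -/
def Unreported (G : ℕ → SimpleGraph (Fin n)) (i : ℕ) (v u w : Fin n) : Prop :=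
  w ∈ (run G i u).pending ∨ u ∈ (run G i w).pending ∨
    (u ∈ (run G i v).pending ∨ (run G i v).asked = some u) ∨
    (w ∈ (run G i v).pending ∨ (run G i v).asked = some w)

theorem mem_pending_or_asked {i : ℕ} {v u : Fin n}
    (h : u ∈ (reacted (G i) (G (i + 1)) (run G i) v).pending) :
    u ∈ (run G (i + 1) v).pending ∨ (run G (i + 1) v).asked = some u :=
  (ListingState.topic_or_remaining h).symm

theorem mem_pending_of_changed {i : ℕ} {v u : Fin n}
    (h : ¬ ((G i).Adj v u ↔ (G (i + 1)).Adj v u)) :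
    u ∈ (reacted (G i) (G (i + 1)) (run G i) v).pending := by
  simp only [reacted, ListingState.react, Set.mem_union, Set.mem_sdiff, SimpleGraph.mem_neighborSet]
  tauto

theorem mem_pending_of_mem {i : ℕ} {v u : Fin n} (h : u ∈ (run G i v).pending) :
    u ∈ (reacted (G i) (G (i + 1)) (run G i) v).pending :=
  Or.inl h

theorem told_of_topic {i : ℕ} {v u w : Fin n} (h : (G (i + 1)).Adj v u)
    (ht : (reacted (G i) (G (i + 1)) (run G i) u).topic = some w) :
    ∃ a, (reacted (G i) (G (i + 1)) (run G i) v).Told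
      (inbox (G (i + 1)) (reacted (G i) (G (i + 1)) (run G i)) v) u w a :=
  ⟨_, _, if_pos h, .inl ⟨ht, rfl⟩⟩

theorem told_of_asked {i : ℕ} {v u w : Fin n} (h : (G (i + 1)).Adj v u)
    (ht : (run G i v).asked = some w) :
    ∃ a, (reacted (G i) (G (i + 1)) (run G i) v).Told
      (inbox (G (i + 1)) (reacted (G i) (G (i + 1)) (run G i)) v) u w a :=
  ⟨_, _, if_pos h, .inr ⟨ht, rfl⟩⟩

/-- For two neighbours `u` and `w` of `v`, the belief of `v` on their adjacency is correct, unless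
it still has to be reported. -/
theorem known_iff_or_unreported (h0 : G 0 = ⊥) (i : ℕ) {v u w : Fin n} (hu : (G i).Adj v u)
    (hw : (G i).Adj v w) :
    ((run G i v).known u w ↔ (G i).Adj u w) ∨ Unreported G i v u w := by
  induction i with
  | zero => simp [h0] at hu
  | succ i ih =>
    -- If `vu` is new, reports from `u` cannot be trusted yet, but `u` has just entered the queue of
    -- `v`.
    by_cases hu' : (G i).Adj v u
    swap
    · exact .inr (.inr (.inr (.inl (mem_pending_or_asked (mem_pending_of_changed (by tauto))))))
    by_cases hw' : (G i).Adj v w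
    swap
    · exact .inr (.inr (.inr (.inr (mem_pending_or_asked (mem_pending_of_changed (by tauto))))))
    set s := reacted (G i) (G (i + 1)) (run G i) with hs
    set I := inbox (G (i + 1)) s v with hI
    have hknown : (run G (i + 1) v).known u w ↔
        ((s v).Told I u w true ∨ (s v).Told I w u true) ∨
          ((run G i v).known u w ∧ ¬ ((s v).Told I u w false ∨ (s v).Told I w u false)) := Iff.rfl
    have htold : ∀ a, ((s v).Told I u w a ∨ (s v).Told I w u a) →
        (a = true ↔ (G (i + 1)).Adj u w) := by
      rintro a (h | h)
      · exact told_iff h0 hu' hu h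
      · rw [SimpleGraph.adj_comm]
        exact told_iff h0 hw' hw h
    -- All reports of this round are true, so they cannot conflict and any one of them fixes the
    -- belief.
    have hreport : (∃ a, (s v).Told I u w a ∨ (s v).Told I w u a) →
        ((run G (i + 1) v).known u w ↔ (G (i + 1)).Adj u w) := by
      rintro ⟨a, ha⟩
      have ht := htold true
      have hf := htold false
      rw [hknown]
      cases a <;> simp_all
    have hkeep : ((run G i v).known u w ↔ (G (i + 1)).Adj u w) →
        ((run G (i + 1) v).known u w ↔ (G (i + 1)).Adj u w) := by
      intro h
      have ht := htold true
      have hf := htold false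
      rw [hknown]
      simp only [true_iff, Bool.false_eq_true, false_iff] at ht hf
      tauto
    have hpu : w ∈ (s u).pending →
        ((run G (i + 1) v).known u w ↔ (G (i + 1)).Adj u w) ∨ Unreported G (i + 1) v u w := by
      intro h
      rcases ListingState.topic_or_remaining h with h | h
      · exact .inl (hreport ((told_of_topic hu h).imp fun _ => .inl))
      · exact .inr (.inl h)
    by_cases huw : (G i).Adj u w ↔ (G (i + 1)).Adj u w
    swap
    · exact hpu (mem_pending_of_changed huw)
    -- Each reason for a due report either persists or is resolved now: a queued item is announced,
    -- and a question asked by `v` about one of `u`, `w` is answered by the other.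
    rcases ih hu' hw' with h | h | h | (h | h) | (h | h)
    · exact .inl (hkeep (h.trans huw))
    · exact hpu (mem_pending_of_mem h)
    · rcases ListingState.topic_or_remaining (mem_pending_of_mem (i := i) h) with h | h
      · exact .inl (hreport ((told_of_topic hw h).imp fun _ => .inr))
      · exact .inr (.inr (.inl h))
    · exact .inr (.inr (.inr (.inl (mem_pending_or_asked (mem_pending_of_mem h)))))
    · exact .inl (hreport ((told_of_asked hw h).imp fun _ => .inr))
    · exact .inr (.inr (.inr (.inr (mem_pending_or_asked (mem_pending_of_mem h)))))
    · exact .inl (hreport ((told_of_asked hu h).imp fun _ => .inl))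

open Classical in
theorem pending_eq_empty_of_adj (h0 : G 0 = ⊥) {i : ℕ} {v u : Fin n} (h : (G i).Adj v u)
    (hb : ¬ (run G i v).neighborBusy) : (run G i u).pending = ∅ := by
  cases i with
  | zero => simp [h0] at h
  | succ i =>
    by_contra hne
    refine hb ⟨u, _, if_pos h, ?_⟩
    exact decide_eq_true (Set.nonempty_iff_ne_empty.mpr hne)

theorem known_iff_of_settled (h0 : G 0 = ⊥) {i : ℕ} {v u w : Fin n} (hs : (run G i v).Settled)
    (hu : (G i).Adj v u) (hw : (G i).Adj v w) : (run G i v).known u w ↔ (G i).Adj u w := by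
  refine (known_iff_or_unreported h0 i hu hw).resolve_right ?_
  simp [Unreported, hs.1, hs.2.1, pending_eq_empty_of_adj h0 hu hs.2.2,
    pending_eq_empty_of_adj h0 hw hs.2.2]

theorem believesClique_iff (h0 : G 0 = ⊥) {i : ℕ} {v : Fin n} (hs : (run G i v).Settled)
    {H : Finset (Fin n)} (hv : v ∈ H) : (run G i v).BelievesClique v H ↔ (G i).IsClique H := by
  constructor
  · intro h u hu w hw huw
    by_cases huv : u = v
    · subst huv
      have := (h w hw huw.symm).1
      rwa [nbrs_run h0] at this
    have hvu : (G i).Adj v u := by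
      have := (h u hu huv).1
      rwa [nbrs_run h0] at this
    by_cases hwv : w = v
    · subst hwv
      exact hvu.symm
    have hvw : (G i).Adj v w := by
      have := (h w hw hwv).1
      rwa [nbrs_run h0] at this
    exact (known_iff_of_settled h0 hs hvu hvw).mp ((h u hu huv).2 w hw hwv huw)
  · intro h u hu huv
    refine ⟨?_, fun w hw hwv huw => ?_⟩
    · rw [nbrs_run h0]
      exact h hv hu huv.symm
    · exact (known_iff_of_settled h0 hs (h hv hu huv.symm) (h hv hw hwv.symm)).mpr (h hu hw huw)

/-! ### Amortized analysis. -/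

/-- The number of announcements still to be made at the end of round `i`. -/
noncomputable def backlog (G : ℕ → SimpleGraph (Fin n)) (i : ℕ) : ℕ :=
  ∑ v, (run G i v).pending.ncard

/-- Handshake lemma for the graph of changed edges. -/
theorem sum_ncard_changes (A B : SimpleGraph (Fin n)) :
    ∑ v, ((B.neighborSet v \ A.neighborSet v) ∪ (A.neighborSet v \ B.neighborSet v)).ncard =
      2 * (symmDiff A.edgeSet B.edgeSet).ncard := by
  classical
  have h := (A \ B ⊔ B \ A).sum_degrees_eq_twice_card_edges
  have he : (symmDiff A.edgeSet B.edgeSet).ncard = (A \ B ⊔ B \ A).edgeFinset.card := by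
    rw [← Set.ncard_coe_finset, SimpleGraph.coe_edgeFinset, SimpleGraph.edgeSet_sup,
      SimpleGraph.edgeSet_sdiff, SimpleGraph.edgeSet_sdiff]
    rfl
  rw [he]
  refine Eq.trans ?_ (h.trans (by congr!))
  refine Finset.sum_congr rfl fun v _ => ?_
  rw [← SimpleGraph.card_neighborFinset_eq_degree, ← Set.ncard_coe_finset,
    SimpleGraph.coe_neighborFinset]
  congr 1
  ext u
  simp only [Set.mem_union, Set.mem_sdiff, SimpleGraph.mem_neighborSet, SimpleGraph.sup_adj,
    SimpleGraph.sdiff_adj]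
  tauto

theorem sum_pending_reacted_le (i : ℕ) :
    ∑ v, (reacted (G i) (G (i + 1)) (run G i) v).pending.ncard ≤
      backlog G i + 2 * (symmDiff (G i).edgeSet (G (i + 1)).edgeSet).ncard := by
  rw [← sum_ncard_changes, backlog, ← Finset.sum_add_distrib]
  exact Finset.sum_le_sum fun v _ => Set.ncard_union_le _ _

-- Leftover items, a question just asked and a busy neighbor all stem from a queue that was nonempty
-- in this very round.
open Classical in
theorem exists_pending_of_not_settled {i : ℕ} {v : Fin n} (h : ¬ (run G (i + 1) v).Settled) :
    ∃ u, (reacted (G i) (G (i + 1)) (run G i) u).pending.Nonempty := by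
  by_contra! hne
  have hrem : ∀ u, (run G (i + 1) u).pending = ∅ := fun u =>
    Set.subset_eq_empty (ListingState.remaining_subset _) (hne u)
  refine h ⟨hrem v, ?_, ?_⟩
  · change (reacted (G i) (G (i + 1)) (run G i) v).topic = none
    simp [ListingState.topic, hne v]
  · rintro ⟨u, p, hp, hb⟩
    unfold inbox at hp
    split_ifs at hp
    obtain rfl := Option.some.inj hp
    exact (of_decide_eq_true hb).ne_empty (hrem u)

theorem backlog_succ_le (i : ℕ) :
    backlog G (i + 1) ≤ backlog G i + 2 * (symmDiff (G i).edgeSet (G (i + 1)).edgeSet).ncard :=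
  (Finset.sum_le_sum fun _ _ => Set.ncard_le_ncard (ListingState.remaining_subset _)
    (Set.toFinite _)).trans (sum_pending_reacted_le i)

theorem backlog_succ_lt {i : ℕ} {v : Fin n} (h : ¬ (run G (i + 1) v).Settled) :
    backlog G (i + 1) < backlog G i + 2 * (symmDiff (G i).edgeSet (G (i + 1)).edgeSet).ncard := by
  obtain ⟨u, hu⟩ := exists_pending_of_not_settled h
  refine lt_of_lt_of_le (Finset.sum_lt_sum (fun _ _ => Set.ncard_le_ncard
    (ListingState.remaining_subset _) (Set.toFinite _)) ⟨u, Finset.mem_univ u, ?_⟩)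
    (sum_pending_reacted_le i)
  exact ListingState.ncard_remaining_lt hu

theorem ncard_unsettled_add_backlog_le (G : ℕ → SimpleGraph (Fin n)) (i : ℕ) :
    {j : ℕ | 1 ≤ j ∧ j ≤ i ∧ ∃ v, ¬ (run G j v).Settled}.ncard + backlog G i ≤
      2 * topologyChanges G i := by
  induction i with
  | zero =>
    have h : {j : ℕ | 1 ≤ j ∧ j ≤ 0 ∧ ∃ v, ¬ (run G j v).Settled} = ∅ := by
      ext j
      simp only [Set.mem_ofPred_eq, Set.mem_empty_iff_false, iff_false]
      omega
    rw [h]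
    simp [backlog, run]
  | succ i ih =>
    rw [topologyChanges, Finset.sum_range_succ, ← topologyChanges]
    by_cases hs : ∃ v, ¬ (run G (i + 1) v).Settled
    · have h : {j : ℕ | 1 ≤ j ∧ j ≤ i + 1 ∧ ∃ v, ¬ (run G j v).Settled} ⊆
          insert (i + 1) {j : ℕ | 1 ≤ j ∧ j ≤ i ∧ ∃ v, ¬ (run G j v).Settled} := by
        rintro j ⟨h1, h2, h3⟩
        rcases Nat.le_succ_iff.mp h2 with h | h
        · exact .inr ⟨h1, h, h3⟩
        · exact .inl h
      have hfin : {j : ℕ | 1 ≤ j ∧ j ≤ i ∧ ∃ v, ¬ (run G j v).Settled}.Finite :=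
        (Set.finite_Iic i).subset fun j hj => hj.2.1
      have hle := (Set.ncard_le_ncard h (hfin.insert _)).trans (Set.ncard_insert_le _ _)
      obtain ⟨v, hv⟩ := hs
      have := backlog_succ_lt hv
      omega
    · have h : {j : ℕ | 1 ≤ j ∧ j ≤ i + 1 ∧ ∃ v, ¬ (run G j v).Settled} =
          {j : ℕ | 1 ≤ j ∧ j ≤ i ∧ ∃ v, ¬ (run G j v).Settled} := by
        ext j
        refine ⟨fun ⟨h1, h2, h3⟩ => ⟨h1, ?_, h3⟩, fun ⟨h1, h2, h3⟩ => ⟨h1, by omega, h3⟩⟩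
        rcases Nat.le_succ_iff.mp h2 with h | rfl
        · exact h
        · exact absurd h3 hs
      have := backlog_succ_le (G := G) i
      rw [h]
      omega

end Listing

/-! ### Encoding of packets and conclusion. -/

open Classical in
theorem listingDS_solves {n b : ℕ} {enc : Packet n → Message b} {dec : Message b → Packet n}
    (h : ∀ p, dec (enc p) = p) (k : ℕ) :
    (listingDS enc dec).SolvesCliqueMembershipListing k := by
  intro G h0 i v H hv hH
  rw [Listing.listingDS_run G h]
  unfold DynamicDS.respond
  split_ifs with hc ha
  · refine ⟨fun _ => ⟨?_, hH⟩, by simp⟩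
    exact (Listing.believesClique_iff h0 (of_decide_eq_true hc) hv).mp (of_decide_eq_true ha)
  · refine ⟨by simp, fun _ hcl => ‹¬ _› (decide_eq_true ?_)⟩
    exact (Listing.believesClique_iff h0 (of_decide_eq_true hc) hv).mpr hcl.1
  · simp

theorem listingDS_amortizedRoundsAtMost {n b : ℕ} {enc : Packet n → Message b}
    {dec : Message b → Packet n} (h : ∀ p, dec (enc p) = p) :
    (listingDS enc dec).AmortizedRoundsAtMost 2 := by
  intro G _ i
  refine le_trans (le_of_eq ?_) ((Nat.le_add_right _ (Listing.backlog G i)).trans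
    (Listing.ncard_unsettled_add_backlog_le G i))
  unfold DynamicDS.inconsistentRounds
  congr 1
  ext j
  simp only [Set.mem_ofPred_eq, Listing.listingDS_run G h]
  simp only [listingDS, decide_eq_false_iff_not]

theorem exists_packet_encoding {n b : ℕ} (h : (n + 1) * 8 ≤ 2 ^ b) :
    ∃ (enc : Packet n → Message b) (dec : Message b → Packet n), ∀ p, dec (enc p) = p := by
  have hcard : Fintype.card (Packet n) ≤ Fintype.card (Fin b → Bool) := by
    simpa using h
  obtain ⟨f⟩ := Function.Embedding.nonempty_of_card_le hcard
  have hinj : Function.Injective fun p : Packet n =>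
      (⟨List.ofFn (f p), by simp⟩ : Message b) := by
    intro p q hpq
    exact f.injective (List.ofFn_injective (Subtype.ext_iff.mp hpq))
  exact ⟨_, _, Function.leftInverse_invFun hinj⟩

theorem packet_card_le {n : ℕ} (hn : 2 ≤ n) : (n + 1) * 8 ≤ 2 ^ (5 * Nat.clog 2 n) := by
  have h1 : n ≤ 2 ^ Nat.clog 2 n := Nat.le_pow_clog (by norm_num) n
  have h2 : 1 ≤ Nat.clog 2 n := Nat.clog_pos (by norm_num) hn
  -- Three bits for the flags and one to absorb `n + 1 ≤ 2 * n`; these 4 extra bits cost at most `4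
  -- * Nat.clog 2 n`.
  calc (n + 1) * 8 ≤ 2 ^ Nat.clog 2 n * 2 ^ 4 := by omega
    _ = 2 ^ (Nat.clog 2 n + 4) := (pow_add _ _ _).symm
    _ ≤ 2 ^ (5 * Nat.clog 2 n) := Nat.pow_le_pow_right (by norm_num) (by omega)

/-- The data structure that never communicates and answers every query negatively. -/
def silentDS (n b : ℕ) : DynamicDS n b where
  State := Unit
  init _ := ()
  react _ _ _ _ := ()
  send _ _ _ := ⟨[], Nat.zero_le b⟩
  receive _ _ _ := ()
  consistent _ _ := true
  answer _ _ _ := false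

theorem corollary2 :
    ∃ c C : ℕ, ∀ k : ℕ, 3 ≤ k → ∀ n : ℕ,
      ∃ D : DynamicDS n (c * Nat.clog 2 n),
        D.SolvesCliqueMembershipListing k ∧ D.AmortizedRoundsAtMost C := by
  refine ⟨5, 2, fun k hk n => ?_⟩
  -- For `n < 2` messages have 0 bits and cannot carry packets, but no query has `k ≥ 3` nodes.
  rcases Nat.lt_or_ge n 2 with hn | hn
  · refine ⟨silentDS n _, fun G _ i v H _ hH => ?_, fun G _ i => ?_⟩
    · have := H.card_le_univ
      rw [Fintype.card_fin] at this
      omega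
    · simp [DynamicDS.inconsistentRounds, silentDS]
  · obtain ⟨enc, dec, h⟩ := exists_packet_encoding (packet_card_le hn)
    exact ⟨listingDS enc dec, listingDS_solves h k, listingDS_amortizedRoundsAtMost h⟩
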